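/- Let $K$ be a field of characteristic $p\neq 2$ (the case $p=0$ is allowed) and let $n>1$. Let $\mathcal O(n|n)$ be the supercommutative algebra of divided-power polynomials in even indeterminates $z_1,\dots,z_n$ and odd indeterminates $\xi_1,\dots,\xi_n$, with basis $z^{(\alpha)}\xi^S$ ($\alpha\in\mathbb Z_{\ge0}^n$, $S\subseteq\{1,\dots,n\}$), and let $\mathfrak{vect}(n|n)$ be the Lie superalgebra of the vector fields $\sum_i(F_i\partial_{z_i}+G_i\partial_{\xi_i})$ with $F_i,G_i\in\mathcal O(n|n)$, $\mathbb Z$-graded by $\deg z_i=\deg\xi_i=1$. For a shearing vector $N\in\{1,2,\dots,\infty\}^n$ let $\mathfrak{vect}(n;N|n)$ be the subspace of the fields whose coefficients are combinations of $z^{(\alpha)}\xi^S$ with $\alpha_i<p^{N_i}$ for all $i$ (no restriction on $\alpha_i$ if $N_i=\infty$ or $p=0$). For subspaces $\mathfrak h_{-1}$, $\mathfrak h_0$ of fields of degree $-1$ and $0$, the Cartan prolong is $$(\mathfrak h_{-1},\mathfrak h_0)_{*,N}=\mathfrak h_{-1}\oplus\mathfrak h_0\oplus\bigoplus_{k\ge1}\mathfrak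 h_k,\qquad \mathfrak h_{k}=\{X\in\mathfrak{vect}(n;N|n)_{k}\mid [D,X]\in\mathfrak h_{k-1}\text{ for all }D\in\mathfrak h_{-1}\}.$$ Let $\mathfrak g=\mathfrak q(n+1)$ be the space of pairs $(A,B)$ of $(n+1)\times(n+1)$ matrices over $K$ with rows and columns labelled $0,\dots,n$, where $(A,B)$ stands for the supermatrix $\begin{pmatrix}A&B\\B&A\end{pmatrix}$; put $E_{ij}=(E_{ij},0)$, $X_{ij}=(0,E_{ij})$, and $$\mathfrak g_{-1}=\mathrm{Span}(E_{0i},X_{0i}\mid 1\le i\le n),\qquad \mathfrak g_0=\mathrm{Span}(E_{00},X_{00},E_{ij},X_{ij}\mid 1\le i,j\le n).$$ Let $\varphi:\mathfrak q(n+1)\to\mathfrak{vect}(n|n)$ be the realization by vector fields, that is, the linear map with, for $i,j\ge1$ and with summation over $k=1,\dots,n$, $$E_{0i}\mapsto\partial_{z_i},\quad X_{0i}\mapsto\partial_{\xi_i},\quad E_{ij}\mapsto z_i\partial_{z_j}+\xi_i\partial_{\xi_j},\quad X_{ij}\mapsto z_i\partial_{\xi_j}+\xi_i\partial_{z_j},$$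 $$E_{00}\mapsto-\sum_k(z_k\partial_{z_k}+\xi_k\partial_{\xi_k}),\quad X_{00}\mapsto\sum_k(-z_k\partial_{\xi_k}+\xi_k\partial_{z_k}),$$ $$E_{i0}\mapsto-z_i\sum_k(z_k\partial_{z_k}+\xi_k\partial_{\xi_k})-\xi_i\sum_k(z_k\partial_{\xi_k}-\xi_k\partial_{z_k}),$$ $$X_{i0}\mapsto z_i\sum_k(-z_k\partial_{\xi_k}+\xi_k\partial_{z_k})-\xi_i\sum_k(z_k\partial_{z_k}+\xi_k\partial_{\xi_k}).$$ Finally, identify $\mathfrak{gl}(n|n)$ with the linear vector fields by $E_{ab}\mapsto x_a\partial_{x_b}$, where $x=(z_1,\dots,z_n,\xi_1,\dots,\xi_n)$; let $\mathrm{id}$ be the span of all $\partial_{z_i},\partial_{\xi_i}$, let $\mathfrak q(n)\subset\mathfrak{gl}(n|n)$ be the space of the supermatrices $\begin{pmatrix}A&B\\B&A\end{pmatrix}$, and $J=\begin{pmatrix}0&-1_n\\1_n&0\end{pmatrix}$. Then the sum $\mathfrak q(n)\oplus K\cdot J$ is direct, and for every shearing vector $N$ $$(\varphi(\mathfrak g_{-1}),\varphi(\mathfrak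 g_0))_{*,N}=(\mathrm{id},\mathfrak q(n)\oplus K\cdot J)_{*,N}=\varphi(\mathfrak q(n+1)).$$ -/

import Mathlib

open scoped BigOperators

namespace QueerProlong

/-! ### Divided-power functions in `n` even and `n` odd indeterminates -/

/-- The index `(α, S)` of the monomial `z^{(α)} ξ^S`: here `z^{(α)}` is the product of the divided
powers `z_i^{(α i)}`, and `ξ^S` is the product of the `ξ_i`, `i ∈ S`, in increasing order. -/
abbrev Mono (n : ℕ) : Type := (Fin n → ℕ) × Finset (Fin n)

/-- The supercommutative algebra `O(n|n)` of divided-power polynomials in the even `z_i` and the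
odd `ξ_i`, given by its monomial basis. -/
abbrev SFun (K : Type*) [Field K] (n : ℕ) : Type _ := Mono n →₀ K

/-- The indeterminates: `Sum.inl i` stands for `z_i` and `Sum.inr i` for `ξ_i`. -/
abbrev Ind (n : ℕ) : Type := Fin n ⊕ Fin n

/-- The parity of an indeterminate `x_a`, which is also the parity of `∂_a`. -/
def indParity {n : ℕ} : Ind n → ZMod 2
  | Sum.inl _ => 0
  | Sum.inr _ => 1

/-- The degree of a monomial; all `z_i` and all `ξ_i` have degree `1`. -/
def Mono.deg {n : ℕ} (m : Mono n) : ℕ := (∑ i, m.1 i) + m.2.card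

/-- The parity of a monomial. -/
def Mono.parity {n : ℕ} (m : Mono n) : ZMod 2 := (m.2.card : ZMod 2)

/-- The number of pairs `(s, t) ∈ S × T` with `t < s`, so that
`ξ^S ξ^T = (-1) ^ inversions S T * ξ^(S ∪ T)` for disjoint `S`, `T`. -/
def inversions {n : ℕ} (S T : Finset (Fin n)) : ℕ :=
  ((S ×ˢ T).filter fun q => q.2 < q.1).card

section

variable (K : Type*) [Field K] {n : ℕ}

/-- The product of two monomials: `z_i^{(a)} z_i^{(b)} = (a+b choose a) z_i^{(a+b)}`, the `ξ_i`
anticommute and have square zero. -/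
noncomputable def monoMul (a b : Mono n) : SFun K n :=
  if Disjoint a.2 b.2 then
    Finsupp.single (a.1 + b.1, a.2 ∪ b.2)
      ((-1) ^ inversions a.2 b.2 * ∏ i, (((a.1 i + b.1 i).choose (a.1 i) : ℕ) : K))
  else 0

/-- The multiplication of `O(n|n)`. -/
noncomputable def mulO : SFun K n →ₗ[K] SFun K n →ₗ[K] SFun K n :=
  Finsupp.linearCombination K fun a => Finsupp.linearCombination K fun b => monoMul K a b

/-- The partial derivatives: `∂_{z_i} z_i^{(k)} = z_i^{(k-1)}`, and `∂_{ξ_i}` is the left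
superderivation with `∂_{ξ_i} ξ_j = δ_{ij}`, `∂_{ξ_i} z_j = 0`. -/
noncomputable def pd : Ind n → SFun K n →ₗ[K] SFun K n
  | Sum.inl i => Finsupp.linearCombination K fun m =>
      if m.1 i = 0 then 0 else Finsupp.single (m.1 - Pi.single i 1, m.2) 1
  | Sum.inr i => Finsupp.linearCombination K fun m =>
      if i ∈ m.2 then
        Finsupp.single (m.1, m.2.erase i) ((-1) ^ (m.2.filter fun s => s < i).card)
      else 0

/-- The projection of `O(n|n)` onto the functions of parity `ε`. -/
noncomputable def parityPart (ε : ZMod 2) : SFun K n →ₗ[K] SFun K n :=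
  Finsupp.linearCombination K fun m =>
    if m.parity = ε then Finsupp.single m 1 else 0

/-- The constant function `1`. -/
noncomputable def oneO : SFun K n := Finsupp.single (0, ∅) 1

/-- The indeterminates as functions. -/
noncomputable def coord : Ind n → SFun K n
  | Sum.inl i => Finsupp.single (Pi.single i 1, ∅) 1
  | Sum.inr i => Finsupp.single (0, {i}) 1

end

/-! ### The Lie superalgebra `vect(n|n)` -/

/-- Vector fields `X = ∑_a X_a ∂_a`, given by their coefficients `X_a ∈ O(n|n)`. -/
abbrev Vect (K : Type*) [Field K] (n : ℕ) : Type _ := Ind n → SFun K n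

section

variable (K : Type*) [Field K] {n : ℕ}

/-- The vector field `f ∂_a`. -/
noncomputable def fld (f : SFun K n) (a : Ind n) : Vect K n := Pi.single a f

/-- The product `f X` of a function and a vector field. -/
noncomputable def fmul (f : SFun K n) (X : Vect K n) : Vect K n := fun a => mulO K f (X a)

/-- The action of vector fields on functions: `X f = ∑_a X_a ∂_a f`. -/
noncomputable def act : Vect K n →ₗ[K] SFun K n →ₗ[K] SFun K n :=
  LinearMap.mk₂ K (fun X f => ∑ a, mulO K (X a) (pd K a f))
    (by intros; simp [Finset.sum_add_distrib])
    (by intros; simp [Finset.smul_sum])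
    (by intros; simp [Finset.sum_add_distrib])
    (by intros; simp [Finset.smul_sum])

/-- The projection of `vect(n|n)` onto the fields of parity `ε`; the parity of `f ∂_a` is the sum
of the parities of `f` and of `∂_a`. -/
noncomputable def vectPart (ε : ZMod 2) : Vect K n →ₗ[K] Vect K n :=
  LinearMap.pi fun a => parityPart K (ε + indParity a) ∘ₗ LinearMap.proj a

/-- The superbracket of vector fields: the bilinear map which on fields `X`, `Y` of parities `ε`,
`δ` is the supercommutator `X ∘ Y - (-1) ^ (ε δ) Y ∘ X`. -/
noncomputable def bracket : Vect K n →ₗ[K] Vect K n →ₗ[K] Vect K n :=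
  LinearMap.mk₂ K
    (fun X Y b => ∑ ε : ZMod 2, ∑ δ : ZMod 2,
      (act K (vectPart K ε X) (vectPart K δ Y b)
        - ((-1 : K) ^ (ε.val * δ.val)) • act K (vectPart K δ Y) (vectPart K ε X b)))
    (by
      intros; funext b
      simp only [map_add, LinearMap.add_apply, Pi.add_apply, ← Finset.sum_add_distrib]
      refine Finset.sum_congr rfl fun ε _ => Finset.sum_congr rfl fun δ _ => ?_
      rw [smul_add]; abel)
    (by
      intro c X Y; funext b
      simp only [map_smul, LinearMap.smul_apply, Pi.smul_apply, Finset.smul_sum]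
      refine Finset.sum_congr rfl fun ε _ => Finset.sum_congr rfl fun δ _ => ?_
      rw [smul_sub, smul_comm c])
    (by
      intros; funext b
      simp only [map_add, LinearMap.add_apply, Pi.add_apply, ← Finset.sum_add_distrib]
      refine Finset.sum_congr rfl fun ε _ => Finset.sum_congr rfl fun δ _ => ?_
      rw [smul_add]; abel)
    (by
      intro c X Y; funext b
      simp only [map_smul, LinearMap.smul_apply, Pi.smul_apply, Finset.smul_sum]
      refine Finset.sum_congr rfl fun ε _ => Finset.sum_congr rfl fun δ _ => ?_
      rw [smul_sub, smul_comm c])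

/-- `vect(n; N|n)`, for the shearing vector `N` in characteristic `p`: the coefficients are
combinations of `z^{(α)} ξ^S` with `α i < p ^ N i` for all `i`; no bound on `α i` if `N i = ∞` or
if `p = 0`. -/
noncomputable def shearedVect (p : ℕ) (N : Fin n → ℕ∞) : Submodule K (Vect K n) :=
  Submodule.pi Set.univ fun _ =>
    Finsupp.supported K K {m : Mono n | ∀ i, p = 0 ∨ N i = ⊤ ∨ m.1 i < p ^ (N i).toNat}

/-- The component `vect(n|n)_k`, `k ≥ -1`, of the standard `ℤ`-grading (`deg z_i = deg ξ_i = 1`,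
`deg ∂_a = -1`), with `k = d - 1`: the coefficients are homogeneous of degree `d`. -/
noncomputable def vectCoeffDeg (d : ℕ) : Submodule K (Vect K n) :=
  Submodule.pi Set.univ fun _ => Finsupp.supported K K {m : Mono n | m.deg = d}

/-! ### Cartan prolongation -/

/-- The components of the Cartan prolong of `(gm, g0)`, where `gm` consists of fields of degree
`-1` and `g0` of fields of degree `0`: the component of degree `0` is `g0`, and
`g_{k+1} = {X ∈ vect(n; N|n)_{k+1} | [D, X] ∈ g_k for all D ∈ gm}`. -/
noncomputable def prolongComp (p : ℕ) (N : Fin n → ℕ∞) (gm g0 : Submodule K (Vect K n)) :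
    ℕ → Submodule K (Vect K n)
  | 0 => g0
  | k + 1 => shearedVect K p N ⊓ vectCoeffDeg K (k + 2) ⊓
      ⨅ D ∈ gm, (prolongComp p N gm g0 k).comap (bracket K D)

/-- The Cartan prolong `(gm, g0)_{*,N} = gm ⊕ g0 ⊕ g_1 ⊕ g_2 ⊕ …` in `vect(n; N|n)`. -/
noncomputable def cartanProlong (p : ℕ) (N : Fin n → ℕ∞) (gm g0 : Submodule K (Vect K n)) :
    Submodule K (Vect K n) :=
  gm ⊔ ⨆ k, prolongComp K p N gm g0 k

end

/-! ### The Lie superalgebra `q(n+1)` and its realization by vector fields -/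

/-- The pairs `(A, B)` of `m × m` matrices that parametrize `q(m)`; `(A, 0)` is even and `(0, B)`
is odd. The pair `(A, B)` stands for the supermatrix with rows `(A B)` and `(B A)`. -/
abbrev QPair (K : Type*) [Field K] (m : ℕ) : Type _ :=
  Matrix (Fin m) (Fin m) K × Matrix (Fin m) (Fin m) K

section

variable (K : Type*) [Field K] (n : ℕ)

/-- The basis elements `E_{ij} = (E_{ij}, 0)` of `q(n+1)`, rows and columns labelled `0, …, n`. -/
def unitE (i j : Fin (n + 1)) : QPair K (n + 1) := (Matrix.single i j 1, 0)

/-- The basis elements `X_{ij} = (0, E_{ij})` of `q(n+1)`. -/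
def unitX (i j : Fin (n + 1)) : QPair K (n + 1) := (0, Matrix.single i j 1)

/-- `g_{-1} = Span(E_{0i}, X_{0i} | 1 ≤ i ≤ n)` in `g = q(n+1)`. -/
def qNegOne : Submodule K (QPair K (n + 1)) :=
  Submodule.span K
    (Set.range (fun i : Fin n => unitE K n 0 i.succ) ∪
      Set.range (fun i : Fin n => unitX K n 0 i.succ))

/-- `g_0 = Span(E_{00}, X_{00}, E_{ij}, X_{ij} | 1 ≤ i, j ≤ n)` in `g = q(n+1)`. -/
def qZero : Submodule K (QPair K (n + 1)) :=
  Submodule.span K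
    ({unitE K n 0 0, unitX K n 0 0} ∪
      (Set.range (fun q : Fin n × Fin n => unitE K n q.1.succ q.2.succ) ∪
        Set.range (fun q : Fin n × Fin n => unitX K n q.1.succ q.2.succ)))

end

section

variable (K : Type*) [Field K] {n : ℕ}

/-- The function `z_i`. -/
noncomputable abbrev z (i : Fin n) : SFun K n := coord K (Sum.inl i)

/-- The function `ξ_i`. -/
noncomputable abbrev xi (i : Fin n) : SFun K n := coord K (Sum.inr i)

/-- The vector field `f ∂_{z_i}`. -/
noncomputable abbrev dz (f : SFun K n) (i : Fin n) : Vect K n := fld K f (Sum.inl i)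

/-- The vector field `f ∂_{ξ_i}`. -/
noncomputable abbrev dxi (f : SFun K n) (i : Fin n) : Vect K n := fld K f (Sum.inr i)

/-- The fields `φ(E_{ij})`, `0 ≤ i, j ≤ n`. -/
noncomputable def phiE (i j : Fin (n + 1)) : Vect K n :=
  Fin.cases
    (Fin.cases
      -- `i = 0`, `j = 0`
      (-∑ k, (dz K (z K k) k + dxi K (xi K k) k))
      -- `i = 0`, `j > 0`
      (fun j => dz K (oneO K) j) j)
    (fun i => Fin.cases
      -- `i > 0`, `j = 0`
      (-fmul K (z K i) (∑ k, (dz K (z K k) k + dxi K (xi K k) k))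
        - fmul K (xi K i) (∑ k, (dxi K (z K k) k - dz K (xi K k) k)))
      -- `i > 0`, `j > 0`
      (fun j => dz K (z K i) j + dxi K (xi K i) j) j) i

/-- The fields `φ(X_{ij})`, `0 ≤ i, j ≤ n`. -/
noncomputable def phiX (i j : Fin (n + 1)) : Vect K n :=
  Fin.cases
    (Fin.cases
      -- `i = 0`, `j = 0`
      (∑ k, (-dxi K (z K k) k + dz K (xi K k) k))
      -- `i = 0`, `j > 0`
      (fun j => dxi K (oneO K) j) j)
    (fun i => Fin.cases
      -- `i > 0`, `j = 0`
      (fmul K (z K i) (∑ k, (-dxi K (z K k) k + dz K (xi K k) k))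
        - fmul K (xi K i) (∑ k, (dz K (z K k) k + dxi K (xi K k) k)))
      -- `i > 0`, `j > 0`
      (fun j => dxi K (z K i) j + dz K (xi K i) j) j) i

end

section

variable (K : Type*) [Field K] (n : ℕ)

/-- The linear map `φ : q(n+1) → vect(n|n)` with the above values on the basis. -/
noncomputable def phi : QPair K (n + 1) →ₗ[K] Vect K n where
  toFun Q := ∑ i, ∑ j, (Q.1 i j • phiE K i j + Q.2 i j • phiX K i j)
  map_add' P Q := by
    simp only [Prod.fst_add, Prod.snd_add, Matrix.add_apply, add_smul, ← Finset.sum_add_distrib]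
    refine Finset.sum_congr rfl fun i _ => Finset.sum_congr rfl fun j _ => ?_
    abel
  map_smul' c Q := by
    simp only [Prod.smul_fst, Prod.smul_snd, Matrix.smul_apply, smul_eq_mul, mul_smul,
      Finset.smul_sum, smul_add, RingHom.id_apply]

/-! ### The pair `(id, q(n) ⊕ K·J)` -/

/-- The tautological `n|n`-dimensional module, realized as `vect(n|n)_{-1}`, the span of all
`∂_{z_i}` and `∂_{ξ_i}`. -/
noncomputable def idModule : Submodule K (Vect K n) :=
  Submodule.span K (Set.range fun a : Ind n => fld K (oneO K) a)

/-- The realization of `gl(n|n)` by linear vector fields, `E_{ab} ↦ x_a ∂_b`. -/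
noncomputable def linField : Matrix (Ind n) (Ind n) K →ₗ[K] Vect K n where
  toFun M := fun b => ∑ a, M a b • coord K a
  map_add' M M' := by
    funext b; simp [add_smul, Finset.sum_add_distrib]
  map_smul' c M := by
    funext b; simp [mul_smul, Finset.smul_sum]

/-- `q(n) ⊂ gl(n|n)`: the supermatrices with rows `(A B)` and `(B A)`. -/
def queer : Submodule K (Matrix (Ind n) (Ind n) K) where
  carrier := {M | ∃ A B : Matrix (Fin n) (Fin n) K, M = Matrix.fromBlocks A B B A}
  add_mem' := by
    rintro _ _ ⟨A, B, rfl⟩ ⟨A', B', rfl⟩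
    exact ⟨A + A', B + B', by rw [Matrix.fromBlocks_add]⟩
  zero_mem' := ⟨0, 0, by rw [Matrix.fromBlocks_zero]⟩
  smul_mem' := by
    rintro c _ ⟨A, B, rfl⟩
    exact ⟨c • A, c • B, by rw [Matrix.fromBlocks_smul]⟩

/-- The odd operator `J`, which supercommutes with `q(n)`; the corresponding linear vector field
is `∑ (-z_i ∂_{ξ_i} + ξ_i ∂_{z_i})`. -/
def opJ : Matrix (Ind n) (Ind n) K := Matrix.fromBlocks 0 (-1) 1 0

end

end QueerProlong

namespace QueerProlong

variable {K : Type*} [Field K] {n : ℕ}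

/-! ### Partial derivatives -/

/-! Bracketing with a constant field `∂_a` differentiates coefficients (`bracket_fld_oneO`), so a
field lies in the next component of the prolong exactly when all its partial derivatives lie in the
previous one, up to degree and shearing conditions (`mem_prolongComp_succ`). Divided powers make
differentiation injective in positive degree in every characteristic (`eq_zero_of_pd_eq_zero`). A
field is thus determined by its derivatives, and these supercommute; the whole computation becomes
linear algebra with supersymmetric families of matrices.

In degree 1 the derivatives give a family `M a` in `q(n) ⊕ K·J` with `M a b c = ± M b a c`. Since 2
is invertible, the symmetry expresses every entry through the coefficients of `J` in the `M a`
(`exists_eq_quadMatrix`). These are `2n` free parameters, matching the fields `φ(E_{k0})` and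
`φ(X_{k0})`; hence the first component is `φ(q(n+1)_1)`.

In degree 2 the derivatives are themselves such quadratic fields. Supersymmetry of the second
derivatives, together with a pair of distinct indices (here `n > 1` enters), kills all parameters
(`eq_zero_of_quadMatrix_comm`). All later components then vanish by injectivity of differentiation.

The shearing vector plays no role: quadratic fields have exponents at most 2, and a positive
characteristic is at least 3. -/

theorem pd_inl_single (i : Fin n) (m : Mono n) (c : K) :
    pd K (Sum.inl i) (Finsupp.single m c) =
      if m.1 i = 0 then 0 else Finsupp.single (m.1 - Pi.single i 1, m.2) c := by
  simp only [pd, Finsupp.linearCombination_single]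
  split_ifs <;> simp

theorem pd_inr_single (i : Fin n) (m : Mono n) (c : K) :
    pd K (Sum.inr i) (Finsupp.single m c) =
      if i ∈ m.2 then
        Finsupp.single (m.1, m.2.erase i) (c * (-1) ^ (m.2.filter fun s => s < i).card)
      else 0 := by
  simp only [pd, Finsupp.linearCombination_single]
  split_ifs <;> simp

/-- In divided powers the derivative is a pure shift of coefficients, with no integer factor that
could vanish in characteristic `p`. -/
theorem pd_inl_apply (i : Fin n) (f : SFun K n) (m : Mono n) :
    pd K (Sum.inl i) f m = f (m.1 + Pi.single i 1, m.2) := by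
  induction f using Finsupp.induction_linear with
  | zero => simp
  | add f g hf hg => simp [hf, hg]
  | single k c =>
    rw [pd_inl_single]
    split_ifs with h
    · rw [Finsupp.single_eq_of_ne]
      · rfl
      · rintro rfl
        simp at h
    · simp only [Finsupp.single_apply]
      congr 1
      refine propext ⟨?_, ?_⟩
      · rintro rfl
        refine Prod.ext (funext fun j => ?_) rfl
        rcases eq_or_ne j i with rfl | hj
        · simp; omega
        · simp [hj]
      · rintro rfl
        simp

theorem pd_inr_apply (i : Fin n) (f : SFun K n) (m : Mono n) :
    pd K (Sum.inr i) f m =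
      if i ∈ m.2 then 0
      else f (m.1, insert i m.2) * (-1) ^ (m.2.filter fun s => s < i).card := by
  induction f using Finsupp.induction_linear with
  | zero => simp
  | add f g hf hg =>
    rw [map_add, Finsupp.add_apply, hf, hg]
    split_ifs <;> simp [add_mul]
  | single k c =>
    rw [pd_inr_single]
    by_cases h : i ∈ k.2
    · rw [if_pos h]
      by_cases hm : i ∈ m.2
      · rw [if_pos hm, Finsupp.single_eq_of_ne]
        rintro rfl
        simp at hm
      · rw [if_neg hm]
        by_cases hk : k = (m.1, insert i m.2)
        · subst hk
          have : (insert i m.2).filter (fun s => s < i) = m.2.filter fun s => s < i := by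
            ext s; simp only [Finset.mem_filter, Finset.mem_insert]; grind
          simp [hm, this]
        · rw [Finsupp.single_eq_of_ne, Finsupp.single_eq_of_ne, zero_mul]
          · exact fun e => hk e.symm
          · rintro rfl
            exact hk (Prod.ext rfl (by simp [Finset.insert_erase h]))
    · rw [if_neg h, Finsupp.single_eq_of_ne]
      · simp
      · rintro rfl
        simp at h

/-- The sign `(-1)^{p(a) p(b)}` of two indeterminates. -/
def indSign (K : Type*) [Field K] : Ind n → Ind n → K
  | Sum.inr _, Sum.inr _ => -1
  | _, _ => 1

theorem pd_comm (a b : Ind n) (f : SFun K n) :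
    pd K a (pd K b f) = indSign K a b • pd K b (pd K a f) := by
  ext m
  rcases a with i | i <;> rcases b with j | j
  · simp [pd_inl_apply, indSign, add_right_comm]
  · simp [pd_inl_apply, pd_inr_apply, indSign]
  · simp [pd_inl_apply, pd_inr_apply, indSign]
  · simp only [pd_inr_apply, indSign, Finsupp.smul_apply, smul_eq_mul]
    rcases eq_or_ne i j with rfl | hij
    · simp
    by_cases hi : i ∈ m.2
    · simp [hi]
    by_cases hj : j ∈ m.2
    · simp [hj]
    simp only [hi, hj, Finset.mem_insert, hij, hij.symm, or_self, if_false,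
      Finset.insert_comm i j, Finset.filter_insert]
    -- The smaller of the two odd indices is counted in the sign of the larger, but not conversely;
    -- this gives the relative sign `-1`.
    rcases lt_or_gt_of_ne hij with h | h
    · rw [if_pos h, if_neg h.not_gt, Finset.card_insert_of_notMem (by simp [hi])]
      ring
    · rw [if_pos h, if_neg h.not_gt, Finset.card_insert_of_notMem (by simp [hj])]
      ring

/-- A monomial of positive degree contains some indeterminate, and its coefficient survives, up to
sign, in the derivative along that indeterminate. -/
theorem eq_zero_of_pd_eq_zero {d : ℕ} {f : SFun K n}
    (hf : f ∈ Finsupp.supported K K {m : Mono n | m.deg = d + 1})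
    (h : ∀ a, pd K a f = 0) : f = 0 := by
  ext ⟨α, S⟩
  by_contra hne
  have hdeg : Mono.deg (α, S) = d + 1 :=
    (Finsupp.mem_supported K f).1 hf (Finsupp.mem_support_iff.2 hne)
  rcases S.eq_empty_or_nonempty with rfl | ⟨i, hi⟩
  · obtain ⟨i, hi⟩ : ∃ i, α i ≠ 0 := by
      by_contra! h0
      simp [Mono.deg, h0] at hdeg
    have := DFunLike.congr_fun (h (Sum.inl i)) (α - Pi.single i 1, ∅)
    rw [pd_inl_apply] at this
    -- The truncated subtraction is exact because `α i ≠ 0`.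
    have e : α - Pi.single i 1 + Pi.single i 1 = α := by
      funext j
      rcases eq_or_ne j i with rfl | hj
      · simp; omega
      · simp [hj]
    simp only [e] at this
    exact hne this
  · have := DFunLike.congr_fun (h (Sum.inr i)) (α, S.erase i)
    rw [pd_inr_apply] at this
    simp only [Finset.mem_erase, ne_eq, not_true_eq_false, false_and, if_false,
      Finset.insert_erase hi, Finsupp.coe_zero, Pi.zero_apply, mul_eq_zero] at this
    exact hne (this.resolve_right (pow_ne_zero _ (by simp)))

theorem pd_oneO (a : Ind n) : pd K a (oneO K) = 0 := by
  rcases a with i | i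
  · simp [oneO, pd_inl_single]
  · simp [oneO, pd_inr_single]

theorem oneO_ne_zero : (oneO K : SFun K n) ≠ 0 := by
  simp [oneO]

theorem pd_coord (a b : Ind n) : pd K a (coord K b) = if a = b then oneO K else 0 := by
  rcases a with i | i <;> rcases b with j | j <;>
    simp only [coord, oneO, pd_inl_single, pd_inr_single, reduceCtorEq, if_false, Sum.inl.injEq,
      Sum.inr.injEq, Finset.notMem_empty, Pi.zero_apply, if_true]
  · rcases eq_or_ne i j with rfl | h
    · simp
    · simp [h]
  · rcases eq_or_ne i j with rfl | h
    · simp [Finset.filter_singleton]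
    · simp [h]

/-! ### Products -/

theorem mulO_single (a b : Mono n) (c d : K) :
    mulO K (Finsupp.single a c) (Finsupp.single b d) = c • d • monoMul K a b := by
  simp [mulO, Finsupp.linearCombination_single]

theorem oneO_mulO (f : SFun K n) : mulO K (oneO K) f = f := by
  induction f using Finsupp.induction_linear with
  | zero => simp
  | add f g hf hg => rw [map_add, hf, hg]
  | single m c => simp [oneO, mulO_single, monoMul, inversions]

/-- The Leibniz rule for a product of two indeterminates. -/
theorem pd_mulO_coord (c a b : Ind n) :
    pd K c (mulO K (coord K a) (coord K b)) =
      (if c = a then coord K b else 0) + indSign K c a • if c = b then coord K a else 0 := by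
  rcases a with i | i <;> rcases b with j | j
  · have hz : mulO K (coord K (Sum.inl i)) (coord K (Sum.inl j)) =
        Finsupp.single (Pi.single i 1 + Pi.single j 1, ∅) (if i = j then (2 : K) else 1) := by
      simp only [coord, mulO_single, monoMul, one_smul, Finset.disjoint_empty_right, if_true,
        Finset.empty_union]
      congr 1
      simp only [inversions, Finset.empty_product, Finset.filter_empty, Finset.card_empty, pow_zero,
        one_mul]
      rw [Finset.prod_eq_single i]
      · rcases eq_or_ne i j with rfl | h
        · simp
        · simp [h]
      · intro k _ hk
        simp [hk]
      · simp
    rw [hz]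
    rcases c with k | k
    · rw [pd_inl_single]
      rcases eq_or_ne k i with rfl | hki
      · rcases eq_or_ne k j with rfl | hkj
        · simp only [if_true, indSign, one_smul, coord, ← Finsupp.single_add]
          simp [one_add_one_eq_two]
        · simp [hkj, indSign, coord]
      · rcases eq_or_ne k j with rfl | hkj
        · simp [hki, hki.symm, indSign, coord]
        · simp [hki, hkj]
    · simp [pd_inr_single]
  · have hz : mulO K (coord K (Sum.inl i)) (coord K (Sum.inr j)) =
        Finsupp.single (Pi.single i 1, {j}) 1 := by
      simp [coord, mulO_single, monoMul, inversions]
    rw [hz]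
    rcases c with k | k
    · rcases eq_or_ne k i with rfl | h
      · simp [pd_inl_single, coord]
      · simp [pd_inl_single, h]
    · rcases eq_or_ne k j with rfl | h
      · simp [pd_inr_single, coord, indSign, Finset.filter_singleton]
      · simp [pd_inr_single, h]
  · have hz : mulO K (coord K (Sum.inr i)) (coord K (Sum.inl j)) =
        Finsupp.single (Pi.single j 1, {i}) 1 := by
      simp [coord, mulO_single, monoMul, inversions]
    rw [hz]
    rcases c with k | k
    · rcases eq_or_ne k j with rfl | h
      · simp [pd_inl_single, coord, indSign]
      · simp [pd_inl_single, h]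
    · rcases eq_or_ne k i with rfl | h
      · simp [pd_inr_single, coord, Finset.filter_singleton]
      · simp [pd_inr_single, h]
  · rcases eq_or_ne i j with rfl | hij
    · have hz : mulO K (coord K (Sum.inr i)) (coord K (Sum.inr i)) = 0 := by
        simp [coord, mulO_single, monoMul]
      rw [hz]
      rcases c with k | k
      · simp
      · simp only [map_zero, indSign]
        split_ifs <;> simp
    · have hz : mulO K (coord K (Sum.inr i)) (coord K (Sum.inr j)) =
          Finsupp.single (0, {i, j}) (if j < i then -1 else 1) := by
        simp only [coord, mulO_single, monoMul, inversions]
        rw [if_pos (by simpa using hij)]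
        simp [Finset.filter_singleton]
        split_ifs <;> simp [Finset.pair_comm]
      rw [hz]
      rcases c with k | k
      · simp [pd_inl_single]
      · rw [pd_inr_single]
        rcases eq_or_ne k i with rfl | hki
        · have : ({k, j} : Finset (Fin n)).erase k = {j} := by ext; simp; grind
          simp only [this]
          simp [hij, coord, Finset.filter_insert, Finset.filter_singleton]
          split_ifs <;> simp
        · rcases eq_or_ne k j with rfl | hkj
          · have : ({i, k} : Finset (Fin n)).erase k = {i} := by ext; simp; grind
            simp only [this]
            simp [hki, coord, Finset.filter_insert, Finset.filter_singleton, indSign]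
            rcases lt_or_gt_of_ne hij with h | h
            · simp [h, h.not_gt]
            · simp [h, h.not_gt]
          · simp [hki, hkj]

/-! ### The bracket with constant fields -/

theorem sum_vectPart (X : Vect K n) : ∑ ε : ZMod 2, vectPart K ε X = X := by
  funext a
  have key : ∀ f : SFun K n, ∑ ε : ZMod 2, parityPart K (ε + indParity a) f = f := by
    intro f
    induction f using Finsupp.induction_linear with
    | zero => simp
    | add f g hf hg => simp only [map_add, Finset.sum_add_distrib, hf, hg]
    | single m c =>
      have : ∀ ε : ZMod 2, m.parity = ε + indParity a ↔ m.parity - indParity a = ε :=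
        fun ε => sub_eq_iff_eq_add.symm
      simp [parityPart, Finsupp.linearCombination_single, this]
  rw [Finset.sum_apply]
  exact key (X a)

theorem act_oneO (X : Vect K n) : act K X (oneO K) = 0 := by
  simp [act, pd_oneO]

/-- The homogeneous parts of a constant field again have constant coefficients, so the second term
of the supercommutator drops out, and the signs with it. -/
theorem act_vectPart_fld_oneO (X : Vect K n) (ε : ZMod 2) (a b : Ind n) :
    act K X (vectPart K ε (fld K (oneO K) a) b) = 0 := by
  have h : ∀ η : ZMod 2, act K X (parityPart K η (oneO K)) = 0 := by
    intro η
    have : parityPart K η (oneO K : SFun K n) = if (0, ∅) ∈ {m : Mono n | m.parity = η}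
        then oneO K else 0 := by
      simp [parityPart, oneO, Finsupp.linearCombination_single]
    rw [this]
    split_ifs
    · exact act_oneO X
    · simp
  simp only [vectPart, LinearMap.pi_apply, LinearMap.comp_apply, LinearMap.proj_apply, fld]
  rcases eq_or_ne b a with rfl | hb
  · simpa using h _
  · simp [hb]

theorem act_fld_oneO (a : Ind n) (f : SFun K n) : act K (fld K (oneO K) a) f = pd K a f := by
  simp only [act, LinearMap.mk₂_apply, fld]
  rw [Finset.sum_eq_single a]
  · simp [oneO_mulO]
  · intro b _ hb
    simp [hb]
  · simp

/-- The coefficientwise partial derivative of a vector field. -/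
noncomputable def pdVect (K : Type*) [Field K] {n : ℕ} (a : Ind n) : Vect K n →ₗ[K] Vect K n :=
  LinearMap.pi fun b => pd K a ∘ₗ LinearMap.proj b

theorem pdVect_apply (a b : Ind n) (X : Vect K n) : pdVect K a X b = pd K a (X b) := rfl

theorem bracket_fld_oneO (a : Ind n) (X : Vect K n) :
    bracket K (fld K (oneO K) a) X = pdVect K a X := by
  funext b
  simp only [bracket, LinearMap.mk₂_apply, act_vectPart_fld_oneO, smul_zero, sub_zero]
  have h1 : ∀ ε : ZMod 2, ∑ δ : ZMod 2, act K (vectPart K ε (fld K (oneO K) a)) (vectPart K δ X b) =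
      act K (vectPart K ε (fld K (oneO K) a)) (X b) := by
    intro ε
    rw [← map_sum, ← Finset.sum_apply, sum_vectPart]
  simp only [h1]
  rw [← LinearMap.sum_apply, ← map_sum, sum_vectPart, act_fld_oneO, pdVect_apply]

theorem pdVect_comm (a b : Ind n) (X : Vect K n) :
    pdVect K a (pdVect K b X) = indSign K a b • pdVect K b (pdVect K a X) :=
  funext fun c => pd_comm a b (X c)

theorem eq_zero_of_pdVect_eq_zero {d : ℕ} {X : Vect K n} (hX : X ∈ vectCoeffDeg K (d + 1))
    (h : ∀ a, pdVect K a X = 0) : X = 0 :=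
  funext fun b => eq_zero_of_pd_eq_zero (Submodule.mem_pi.1 hX b trivial)
    fun a => congrFun (h a) b

/-- The bracket condition is linear in `D`, so it suffices to test it on the fields `∂_a`. -/
theorem mem_prolongComp_succ {p : ℕ} {N : Fin n → ℕ∞} {g0 : Submodule K (Vect K n)} {k : ℕ}
    {X : Vect K n} :
    X ∈ prolongComp K p N (idModule K n) g0 (k + 1) ↔
      X ∈ shearedVect K p N ∧ X ∈ vectCoeffDeg K (k + 2) ∧
        ∀ a, pdVect K a X ∈ prolongComp K p N (idModule K n) g0 k := by
  have hD : (∀ D ∈ idModule K n,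
      X ∈ (prolongComp K p N (idModule K n) g0 k).comap (bracket K D)) ↔
        ∀ a, pdVect K a X ∈ prolongComp K p N (idModule K n) g0 k := by
    refine ⟨fun h a => ?_, fun h D hD => ?_⟩
    · have := Submodule.mem_comap.1 (h (fld K (oneO K) a) (Submodule.subset_span ⟨a, rfl⟩))
      rwa [bracket_fld_oneO] at this
    · have hle : idModule K n ≤ (prolongComp K p N (idModule K n) g0 k).comap
          ((bracket K).flip X) := by
        refine Submodule.span_le.2 ?_
        rintro _ ⟨a, rfl⟩
        simp only [SetLike.mem_coe, Submodule.mem_comap, LinearMap.flip_apply, bracket_fld_oneO]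
        exact h a
      have := Submodule.mem_comap.1 (hle hD)
      rw [LinearMap.flip_apply] at this
      rwa [Submodule.mem_comap]
  rw [prolongComp, Submodule.mem_inf, Submodule.mem_inf, and_assoc, ← hD]
  simp only [Submodule.mem_iInf]

/-! ### Linear fields -/

theorem linField_apply (M : Matrix (Ind n) (Ind n) K) (b : Ind n) :
    linField K n M b = ∑ a, M a b • coord K a := rfl

theorem pdVect_linField (a : Ind n) (M : Matrix (Ind n) (Ind n) K) (b : Ind n) :
    pdVect K a (linField K n M) b = M a b • oneO K := by
  rw [pdVect_apply, linField_apply, map_sum, Finset.sum_eq_single a]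
  · simp [pd_coord]
  · intro c _ hc
    simp [pd_coord, hc.symm]
  · simp

theorem linField_injective : Function.Injective (linField K n) := by
  intro M M' h
  ext a b
  have := congrFun (congrArg (pdVect K a) h) b
  rw [pdVect_linField, pdVect_linField] at this
  exact smul_left_injective K oneO_ne_zero this

/-- If the derivatives of a field are linear, their matrices are supersymmetric. -/
theorem entry_comm_of_pdVect_eq_linField {X : Vect K n} {M : Ind n → Matrix (Ind n) (Ind n) K}
    (h : ∀ a, pdVect K a X = linField K n (M a)) (a b c : Ind n) :
    M a b c = indSign K b a * M b a c := by
  have := congrFun (pdVect_comm b a X) c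
  rw [h a, h b, Pi.smul_apply, pdVect_linField, pdVect_linField, smul_smul] at this
  exact smul_left_injective K oneO_ne_zero this

/-- Supercommutation of partial derivatives one degree higher, transported to matrices by
injectivity of `linField`. -/
theorem matrix_comm_of_pdVect_eq {X : Vect K n} {Y : Ind n → Vect K n}
    {M : Ind n → Ind n → Matrix (Ind n) (Ind n) K}
    (h : ∀ a, pdVect K a X = Y a) (hY : ∀ a c, pdVect K c (Y a) = linField K n (M a c))
    (a c : Ind n) : M a c = indSign K c a • M c a := by
  have := pdVect_comm c a X
  rw [h a, h c, hY, hY, ← map_smul] at this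
  exact linField_injective this

/-! ### The linear part `q(n) ⊕ K·J` -/

/-- Equality of the off-diagonal blocks `-c` and `c` of `c·J` forces `2c = 0`. -/
theorem disjoint_queer_opJ (h2 : (2 : K) ≠ 0) (hn : 0 < n) :
    Disjoint (queer K n) (Submodule.span K {opJ K n}) := by
  rw [Submodule.disjoint_def]
  rintro M ⟨A, B, rfl⟩ hM
  obtain ⟨c, hc⟩ := Submodule.mem_span_singleton.1 hM
  rw [opJ, Matrix.fromBlocks_smul, Matrix.fromBlocks_inj] at hc
  obtain ⟨h0, h1, h2', -⟩ := hc
  have e1 := congrFun (congrFun h1 ⟨0, hn⟩) ⟨0, hn⟩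
  have e2 := congrFun (congrFun h2' ⟨0, hn⟩) ⟨0, hn⟩
  simp at e1 e2
  have hc0 : c = 0 := by
    have : 2 * c = 0 := by linear_combination e2 - e1
    exact (mul_eq_zero.1 this).resolve_left h2
  rw [← h0, ← h2', hc0, zero_smul, zero_smul, Matrix.fromBlocks_zero]

/-- A normal form: the diagonal blocks agree, and the off-diagonal ones differ by a scalar matrix,
which records the coefficient of `J`. -/
theorem mem_queer_sup_opJ {M : Matrix (Ind n) (Ind n) K} :
    M ∈ queer K n ⊔ Submodule.span K {opJ K n} ↔
      ∃ A B : Matrix (Fin n) (Fin n) K, ∃ c : K,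
        M = Matrix.fromBlocks A (B - c • (1 : Matrix (Fin n) (Fin n) K))
          (B + c • (1 : Matrix (Fin n) (Fin n) K)) A := by
  have e : ∀ A B : Matrix (Fin n) (Fin n) K, ∀ c : K,
      Matrix.fromBlocks A B B A + c • opJ K n =
        Matrix.fromBlocks A (B - c • (1 : Matrix (Fin n) (Fin n) K))
          (B + c • (1 : Matrix (Fin n) (Fin n) K)) A := by
    intro A B c
    rw [opJ, Matrix.fromBlocks_smul, Matrix.fromBlocks_add, smul_zero, add_zero, smul_neg,
      sub_eq_add_neg]
  constructor
  · intro h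
    obtain ⟨_, ⟨A, B, rfl⟩, y, hy, rfl⟩ := Submodule.mem_sup.1 h
    obtain ⟨c, rfl⟩ := Submodule.mem_span_singleton.1 hy
    exact ⟨A, B, c, e A B c⟩
  · rintro ⟨A, B, c, rfl⟩
    rw [← e]
    exact Submodule.add_mem_sup ⟨A, B, rfl⟩
      (Submodule.smul_mem _ _ (Submodule.mem_span_singleton_self _))

/-! ### The values of `φ` -/

theorem phi_unitE (i j : Fin (n + 1)) : phi K n (unitE K n i j) = phiE K i j := by
  simp only [phi, unitE, LinearMap.coe_mk, AddHom.coe_mk, Matrix.single_apply, Matrix.zero_apply,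
    zero_smul, add_zero]
  rw [Finset.sum_eq_single i, Finset.sum_eq_single j]
  · simp
  · intro b _ hb; simp [hb.symm]
  · simp
  · intro b _ hb; simp [hb.symm]
  · simp

theorem phi_unitX (i j : Fin (n + 1)) : phi K n (unitX K n i j) = phiX K i j := by
  simp only [phi, unitX, LinearMap.coe_mk, AddHom.coe_mk, Matrix.single_apply, Matrix.zero_apply,
    zero_smul, zero_add]
  rw [Finset.sum_eq_single i, Finset.sum_eq_single j]
  · simp
  · intro b _ hb; simp [hb.symm]
  · simp
  · intro b _ hb; simp [hb.symm]
  · simp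

theorem phiE_zero_succ (j : Fin n) : phiE K 0 j.succ = fld K (oneO K) (Sum.inl j) := rfl

theorem phiX_zero_succ (j : Fin n) : phiX K 0 j.succ = fld K (oneO K) (Sum.inr j) := rfl

theorem fld_apply (f : SFun K n) (a b : Ind n) : fld K f a b = if b = a then f else 0 := by
  simp [fld, Pi.single_apply]

theorem phiE_succ_succ (i j : Fin n) :
    phiE K i.succ j.succ =
      linField K n (Matrix.fromBlocks (Matrix.single i j 1) 0 0 (Matrix.single i j 1)) := by
  funext b
  change (dz K (z K i) j + dxi K (xi K i) j) b = _
  rcases b with b | b <;>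
    simp [linField_apply, fld_apply, Matrix.single_apply, ite_and, eq_comm (a := j)]

theorem phiX_succ_succ (i j : Fin n) :
    phiX K i.succ j.succ =
      linField K n (Matrix.fromBlocks 0 (Matrix.single i j 1) (Matrix.single i j 1) 0) := by
  funext b
  change (dxi K (z K i) j + dz K (xi K i) j) b = _
  rcases b with b | b <;>
    simp [linField_apply, fld_apply, Matrix.single_apply, ite_and, eq_comm (a := j)]

theorem phiE_zero_zero : phiE K (0 : Fin (n + 1)) 0 = linField K n (-1) := by
  funext b
  change (-∑ k, (dz K (z K k) k + dxi K (xi K k) k)) b = _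
  rcases b with b | b <;> simp [linField_apply, fld_apply, Matrix.one_apply]

theorem phiX_zero_zero : phiX K (0 : Fin (n + 1)) 0 = linField K n (opJ K n) := by
  funext b
  change (∑ k, (-dxi K (z K k) k + dz K (xi K k) k)) b = _
  rcases b with b | b <;> simp [linField_apply, fld_apply, opJ, Matrix.one_apply]

theorem map_phi_qNegOne : (qNegOne K n).map (phi K n) = idModule K n := by
  rw [qNegOne, idModule, Submodule.map_span, Set.image_union, ← Set.range_comp, ← Set.range_comp]
  congr 1
  rw [← Set.Sum.elim_range]
  congr 1
  funext a
  rcases a with a | a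
  · simp [phi_unitE, phiE_zero_succ]
  · simp [phi_unitX, phiX_zero_succ]

/-- `E_{00}` acts as minus the identity, which already lies in `q(n)`; the only new operator comes
from `X_{00}`, which gives `J`. -/
theorem map_phi_qZero :
    (qZero K n).map (phi K n) =
      (queer K n ⊔ Submodule.span K {opJ K n}).map (linField K n) := by
  apply le_antisymm
  · rw [qZero, Submodule.map_span_le]
    have hq : ∀ A B : Matrix (Fin n) (Fin n) K, linField K n (Matrix.fromBlocks A B B A) ∈
        (queer K n ⊔ Submodule.span K {opJ K n}).map (linField K n) := fun A B =>
      Submodule.mem_map_of_mem (Submodule.mem_sup_left ⟨A, B, rfl⟩)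
    rintro _ ((rfl | rfl) | ⟨⟨i, j⟩, rfl⟩ | ⟨⟨i, j⟩, rfl⟩)
    · rw [phi_unitE, phiE_zero_zero]
      have := hq (-1) 0
      rwa [← neg_zero, ← Matrix.fromBlocks_neg, Matrix.fromBlocks_one] at this
    · rw [phi_unitX, phiX_zero_zero]
      exact Submodule.mem_map_of_mem
        (Submodule.mem_sup_right (Submodule.mem_span_singleton_self _))
    · rw [phi_unitE, phiE_succ_succ]
      exact hq _ _
    · rw [phi_unitX, phiX_succ_succ]
      exact hq _ _
  · rw [Submodule.map_sup, sup_le_iff, Submodule.map_span_le]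
    constructor
    · rintro _ ⟨_, ⟨A, B, rfl⟩, rfl⟩
      have e : Matrix.fromBlocks A B B A = ∑ i, ∑ j,
          (A i j • Matrix.fromBlocks (Matrix.single i j (1 : K)) 0 0 (Matrix.single i j 1) +
            B i j • Matrix.fromBlocks 0 (Matrix.single i j (1 : K)) (Matrix.single i j 1) 0) := by
        ext a b
        rcases a with a | a <;> rcases b with b | b <;>
          simp [Matrix.sum_apply, Matrix.single_apply, ite_and]
      rw [e]
      simp only [map_sum, map_add, map_smul, ← phiE_succ_succ, ← phiX_succ_succ, ← phi_unitE,
        ← phi_unitX]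
      refine Submodule.sum_mem _ fun i _ => Submodule.sum_mem _ fun j _ => Submodule.add_mem _
        (Submodule.smul_mem _ _ (Submodule.mem_map_of_mem (Submodule.subset_span ?_)))
        (Submodule.smul_mem _ _ (Submodule.mem_map_of_mem (Submodule.subset_span ?_)))
      · exact Or.inr (Or.inl ⟨(i, j), rfl⟩)
      · exact Or.inr (Or.inr ⟨(i, j), rfl⟩)
    · rintro _ rfl
      rw [← phiX_zero_zero, ← phi_unitX]
      exact Submodule.mem_map_of_mem (Submodule.subset_span (Or.inl (Or.inr rfl)))

/-! ### The quadratic fields in the image of `φ` -/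

theorem phiE_succ_zero_inl (i j : Fin n) :
    phiE K i.succ 0 (Sum.inl j) =
      -mulO K (z K i) (z K j) + mulO K (xi K i) (xi K j) := by
  change (-fmul K (z K i) (∑ k, (dz K (z K k) k + dxi K (xi K k) k))
        - fmul K (xi K i) (∑ k, (dxi K (z K k) k - dz K (xi K k) k))) (Sum.inl j) = _
  simp [fmul, fld_apply]

theorem phiE_succ_zero_inr (i j : Fin n) :
    phiE K i.succ 0 (Sum.inr j) =
      -mulO K (z K i) (xi K j) - mulO K (xi K i) (z K j) := by
  change (-fmul K (z K i) (∑ k, (dz K (z K k) k + dxi K (xi K k) k))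
        - fmul K (xi K i) (∑ k, (dxi K (z K k) k - dz K (xi K k) k))) (Sum.inr j) = _
  simp [fmul, fld_apply]

theorem phiX_succ_zero_inl (i j : Fin n) :
    phiX K i.succ 0 (Sum.inl j) =
      mulO K (z K i) (xi K j) - mulO K (xi K i) (z K j) := by
  change (fmul K (z K i) (∑ k, (-dxi K (z K k) k + dz K (xi K k) k))
        - fmul K (xi K i) (∑ k, (dz K (z K k) k + dxi K (xi K k) k))) (Sum.inl j) = _
  simp [fmul, fld_apply]

theorem phiX_succ_zero_inr (i j : Fin n) :
    phiX K i.succ 0 (Sum.inr j) =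
      -mulO K (z K i) (z K j) - mulO K (xi K i) (xi K j) := by
  change (fmul K (z K i) (∑ k, (-dxi K (z K k) k + dz K (xi K k) k))
        - fmul K (xi K i) (∑ k, (dz K (z K k) k + dxi K (xi K k) k))) (Sum.inr j) = _
  simp [fmul, fld_apply]

/-- The field `∑_k (l_k φ(X_{k0}) + m_k φ(E_{k0}))`. -/
noncomputable def quadField (l m : Fin n → K) : Vect K n :=
  ∑ k : Fin n, (l k • phiX K k.succ 0 + m k • phiE K k.succ 0)

/-- The matrices of the linear fields `∂_a X`, where `X` is `quadField l m`. -/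
def quadMatrix (l m : Fin n → K) : Ind n → Matrix (Ind n) (Ind n) K
  | Sum.inl k => Matrix.fromBlocks
      (Matrix.of fun i j => -((if i = j then m k else 0) + if k = j then m i else 0))
      (Matrix.of fun i j => (-if k = j then l i else 0) - if i = j then l k else 0)
      (Matrix.of fun i j => (-if k = j then l i else 0) + if i = j then l k else 0)
      (Matrix.of fun i j => -((if i = j then m k else 0) + if k = j then m i else 0))
  | Sum.inr k => Matrix.fromBlocks
      (Matrix.of fun i j => (if k = j then l i else 0) - if i = j then l k else 0)
      (Matrix.of fun i j => (-if k = j then m i else 0) - if i = j then m k else 0)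
      (Matrix.of fun i j => (-if k = j then m i else 0) + if i = j then m k else 0)
      (Matrix.of fun i j => (if k = j then l i else 0) - if i = j then l k else 0)

/-- The parameters are exactly the coefficients of `J`: `l k` for the derivative along `z_k`, and `m
k` for the one along `ξ_k`. -/
theorem quadMatrix_mem (l m : Fin n → K) (a : Ind n) :
    quadMatrix l m a ∈ queer K n ⊔ Submodule.span K {opJ K n} := by
  rw [mem_queer_sup_opJ]
  rcases a with k | k
  · refine ⟨Matrix.of fun i j => -((if i = j then m k else 0) + if k = j then m i else 0),
      Matrix.of fun i j => (-if k = j then l i else 0), l k, ?_⟩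
    rw [quadMatrix, Matrix.fromBlocks_inj]
    refine ⟨rfl, ?_, ?_, rfl⟩ <;> ext i j <;> simp [Matrix.one_apply]
  · refine ⟨Matrix.of fun i j => (if k = j then l i else 0) - if i = j then l k else 0,
      Matrix.of fun i j => (-if k = j then m i else 0), m k, ?_⟩
    rw [quadMatrix, Matrix.fromBlocks_inj]
    refine ⟨rfl, ?_, ?_, rfl⟩ <;> ext i j <;> simp [Matrix.one_apply]

theorem pdVect_quadField (l m : Fin n → K) (a : Ind n) :
    pdVect K a (quadField l m) = linField K n (quadMatrix l m a) := by
  funext b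
  rw [linField_apply, pdVect_apply, quadField, Finset.sum_apply, map_sum, Fintype.sum_sum_type]
  rcases a with k | k <;> rcases b with j | j <;>
    simp only [Pi.add_apply, Pi.smul_apply, map_add, map_smul, phiE_succ_zero_inl,
      phiE_succ_zero_inr, phiX_succ_zero_inl, phiX_succ_zero_inr, map_sub, map_neg,
      pd_mulO_coord, quadMatrix, Matrix.fromBlocks_apply₁₁, Matrix.fromBlocks_apply₁₂,
      Matrix.fromBlocks_apply₂₁, Matrix.fromBlocks_apply₂₂, Matrix.of_apply, indSign, one_smul,
      Sum.inl.injEq, Sum.inr.injEq, reduceCtorEq, if_false, add_zero, zero_add, smul_add, smul_sub,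
      smul_neg, neg_smul, add_smul, sub_smul, Finset.sum_add_distrib, Finset.sum_sub_distrib,
      Finset.sum_neg_distrib, smul_ite, ite_smul, smul_zero, zero_smul, Finset.sum_ite_eq,
      Finset.sum_ite_eq', Finset.mem_univ, if_true, neg_add_rev, neg_zero, sub_zero] <;>
    split_ifs <;> (try simp) <;> (try abel)

/-! ### Membership of the quadratic fields in the prolong -/

/-- The degree places the quadratic fields in the grading; the bound on the exponents places them in
every sheared algebra. -/
theorem mulO_coord_mem_supported (a b : Ind n) :
    mulO K (coord K a) (coord K b) ∈
      Finsupp.supported K K {m : Mono n | m.deg = 2 ∧ ∀ i, m.1 i ≤ 2} := by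
  have hp : ∀ (i k : Fin n), (Pi.single i 1 : Fin n → ℕ) k ≤ 1 := fun i k => by
    rw [Pi.single_apply]; split_ifs <;> omega
  rcases a with i | i <;> rcases b with j | j <;>
    simp only [coord, mulO_single, monoMul, one_smul] <;> split_ifs with h <;>
    first
    | exact Submodule.zero_mem _
    | (refine Finsupp.single_mem_supported K _ ⟨?_, fun k => ?_⟩)
  · simp [Mono.deg, Finset.sum_add_distrib]
  · have := hp i k; have := hp j k; simp only [Pi.add_apply]; omega
  · simp [Mono.deg]
  · have := hp i k; simp only [Pi.add_apply, Pi.zero_apply]; omega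
  · simp [Mono.deg]
  · have := hp j k; simp only [Pi.add_apply, Pi.zero_apply]; omega
  · rw [Finset.disjoint_singleton] at h
    simp [Mono.deg, Finset.card_pair h]
  · simp

theorem quadField_apply_mem_supported (l m : Fin n → K) (b : Ind n) :
    quadField l m b ∈ Finsupp.supported K K {m : Mono n | m.deg = 2 ∧ ∀ i, m.1 i ≤ 2} := by
  rw [quadField, Finset.sum_apply]
  refine Submodule.sum_mem _ fun k _ => Submodule.add_mem _
    (Submodule.smul_mem _ _ ?_) (Submodule.smul_mem _ _ ?_) <;>
  rcases b with j | j
  · rw [phiX_succ_zero_inl]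
    exact Submodule.sub_mem _ (mulO_coord_mem_supported _ _) (mulO_coord_mem_supported _ _)
  · rw [phiX_succ_zero_inr]
    exact Submodule.sub_mem _ (Submodule.neg_mem _ (mulO_coord_mem_supported _ _))
      (mulO_coord_mem_supported _ _)
  · rw [phiE_succ_zero_inl]
    exact Submodule.add_mem _ (Submodule.neg_mem _ (mulO_coord_mem_supported _ _))
      (mulO_coord_mem_supported _ _)
  · rw [phiE_succ_zero_inr]
    exact Submodule.sub_mem _ (Submodule.neg_mem _ (mulO_coord_mem_supported _ _))
      (mulO_coord_mem_supported _ _)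

theorem quadField_mem_vectCoeffDeg (l m : Fin n → K) : quadField l m ∈ vectCoeffDeg K 2 :=
  Submodule.mem_pi.2 fun b _ =>
    Finsupp.supported_mono (fun _ h => h.1) (quadField_apply_mem_supported l m b)

theorem quadField_mem_shearedVect {p : ℕ} [CharP K p] (hp : p ≠ 2) {N : Fin n → ℕ∞}
    (hN : ∀ i, 1 ≤ N i) (l m : Fin n → K) : quadField l m ∈ shearedVect K p N := by
  refine Submodule.mem_pi.2 fun b _ =>
    Finsupp.supported_mono (fun s h i => ?_) (quadField_apply_mem_supported l m b)
  rcases CharP.char_is_prime_or_zero K p with hpr | h0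
  · rcases eq_or_ne (N i) ⊤ with ht | ht
    · exact Or.inr (Or.inl ht)
    · refine Or.inr (Or.inr ?_)
      have h1 : 1 ≤ (N i).toNat := by
        have := hN i
        rw [← ENat.natCast_toNat ht] at this
        exact_mod_cast this
      have h2 : p ^ 1 ≤ p ^ (N i).toNat := Nat.pow_le_pow_right hpr.pos h1
      rw [pow_one] at h2
      have h3 := hpr.two_le
      have h4 := h.2 i
      -- Here `p ≥ 3`, so the exponents satisfy `2 < p ≤ p ^ N i`.
      omega
  · exact Or.inl h0

/-! ### The first and the second component of the prolong -/

/-- Supersymmetric families of matrices in `q(n) ⊕ K·J` come from quadratic fields `φ(q(n+1)_1)`. -/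
theorem exists_eq_quadMatrix (h2 : (2 : K) ≠ 0) {M : Ind n → Matrix (Ind n) (Ind n) K}
    (hM : ∀ a, M a ∈ queer K n ⊔ Submodule.span K {opJ K n})
    (hs : ∀ a b c, M a b c = indSign K b a * M b a c) :
    ∃ l m : Fin n → K, ∀ a, M a = quadMatrix l m a := by
  choose A B c hABc using fun a => mem_queer_sup_opJ.1 (hM a)
  have e11 : ∀ a i j, M a (Sum.inl i) (Sum.inl j) = A a i j := fun a i j => by rw [hABc]; simp
  have e22 : ∀ a i j, M a (Sum.inr i) (Sum.inr j) = A a i j := fun a i j => by rw [hABc]; simp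
  have e12 : ∀ a i j, M a (Sum.inl i) (Sum.inr j) = B a i j - if i = j then c a else 0 :=
    fun a i j => by rw [hABc]; simp [Matrix.one_apply]
  have e21 : ∀ a i j, M a (Sum.inr i) (Sum.inl j) = B a i j + if i = j then c a else 0 :=
    fun a i j => by rw [hABc]; simp [Matrix.one_apply]
  -- Symmetry in two even directions competes with antisymmetry in two odd ones. The mixed relations
  -- link them, since the diagonal blocks coincide and the off-diagonal ones differ only by `J`.
  -- Everything but twice the wanted entry and the `J`-terms cancels; `hA` uses the same cycle.
  have hB : ∀ k i j, B (Sum.inl k) i j = -if k = j then c (Sum.inl i) else 0 := by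
    intro k i j
    have h1 := hs (Sum.inl k) (Sum.inl i) (Sum.inr j)
    have h3 := hs (Sum.inl k) (Sum.inr i) (Sum.inl j)
    have h4 := hs (Sum.inl i) (Sum.inr k) (Sum.inl j)
    have h5 := hs (Sum.inr k) (Sum.inr i) (Sum.inr j)
    simp only [e11, e12, e21, e22, indSign, one_mul] at h1 h3 h4 h5
    refine mul_left_cancel₀ h2 ?_
    linear_combination h1 + h3 + h4 + h5
  have hA : ∀ k i j, A (Sum.inl k) i j =
      -((if i = j then c (Sum.inr k) else 0) + if k = j then c (Sum.inr i) else 0) := by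
    intro k i j
    have h1 := hs (Sum.inl k) (Sum.inl i) (Sum.inl j)
    have h3 := hs (Sum.inl k) (Sum.inr i) (Sum.inr j)
    have h4 := hs (Sum.inl i) (Sum.inr k) (Sum.inr j)
    have h5 := hs (Sum.inr k) (Sum.inr i) (Sum.inl j)
    simp only [e11, e12, e21, e22, indSign, one_mul] at h1 h3 h4 h5
    refine mul_left_cancel₀ h2 ?_
    linear_combination h1 + h3 + h4 + h5
  -- The odd directions follow from the even ones by a single mixed exchange.
  have hB' : ∀ k i j, B (Sum.inr k) i j = -if k = j then c (Sum.inr i) else 0 := by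
    intro k i j
    have h := hs (Sum.inl i) (Sum.inr k) (Sum.inr j)
    simp only [e12, e22, indSign, one_mul, hA] at h
    linear_combination -h
  have hA' : ∀ k i j, A (Sum.inr k) i j =
      (if k = j then c (Sum.inl i) else 0) - if i = j then c (Sum.inl k) else 0 := by
    intro k i j
    have h := hs (Sum.inl i) (Sum.inr k) (Sum.inl j)
    simp only [e11, e21, indSign, one_mul, hB] at h
    linear_combination -h
  refine ⟨fun k => c (Sum.inl k), fun k => c (Sum.inr k), fun a => ?_⟩
  ext x y
  rcases a with k | k <;> rcases x with i | i <;> rcases y with j | j <;>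
    simp only [e11, e12, e21, e22, hA, hA', hB, hB', quadMatrix, Matrix.fromBlocks_apply₁₁,
      Matrix.fromBlocks_apply₁₂, Matrix.fromBlocks_apply₂₁, Matrix.fromBlocks_apply₂₂,
      Matrix.of_apply]

/-- The matrices of the derivatives select a quadratic field with the same derivatives as `X`; the
difference vanishes because its coefficients have positive degree. -/
theorem eq_quadField_of_pdVect_mem (h2 : (2 : K) ≠ 0) {X : Vect K n}
    (hdeg : X ∈ vectCoeffDeg K 2)
    (hX : ∀ a, pdVect K a X ∈
      (queer K n ⊔ Submodule.span K {opJ K n}).map (linField K n)) :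
    ∃ l m, X = quadField l m := by
  choose M hM hMX using fun a => Submodule.mem_map.1 (hX a)
  obtain ⟨l, m, hlm⟩ := exists_eq_quadMatrix h2 hM
    (entry_comm_of_pdVect_eq_linField fun a => (hMX a).symm)
  refine ⟨l, m, sub_eq_zero.1 (eq_zero_of_pdVect_eq_zero (d := 1)
    (Submodule.sub_mem _ hdeg (quadField_mem_vectCoeffDeg l m)) fun a => ?_)⟩
  rw [map_sub, pdVect_quadField, ← hMX, hlm, sub_self]

theorem quadField_zero : quadField (0 : Fin n → K) 0 = 0 := by
  simp [quadField]

theorem eq_zero_of_quadMatrix_comm (h2 : (2 : K) ≠ 0) (hn : 1 < n) {l m : Ind n → Fin n → K}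
    (h : ∀ a c, quadMatrix (l a) (m a) c = indSign K c a • quadMatrix (l c) (m c) a) :
    l = 0 ∧ m = 0 := by
  have : Nontrivial (Fin n) := Fin.nontrivial_iff_two_le.2 hn
  have entry : ∀ a c x y, quadMatrix (l a) (m a) c x y =
      indSign K c a * quadMatrix (l c) (m c) a x y := fun a c x y => by
    rw [h a c]; rfl
  -- Taking column `k ≠ s` removes the `s = k` terms on the right. The remaining `i = k` terms come
  -- from `J` and have opposite signs in the two off-diagonal blocks, so adding the two equations
  -- isolates `2 l`. The next two claims use the same device.
  have hl : ∀ s i, l (Sum.inl s) i = 0 := by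
    intro s i
    obtain ⟨k, hk⟩ := exists_ne s
    have h1 := entry (Sum.inl s) (Sum.inl k) (Sum.inl i) (Sum.inr k)
    have h3 := entry (Sum.inl s) (Sum.inl k) (Sum.inr i) (Sum.inl k)
    simp only [quadMatrix, Matrix.fromBlocks_apply₁₂, Matrix.fromBlocks_apply₂₁, Matrix.of_apply,
      indSign, one_mul, if_true, if_neg hk.symm] at h1 h3
    refine (mul_eq_zero.1 ?_).resolve_left h2
    linear_combination -h1 - h3
  have hm : ∀ k i, m (Sum.inl k) i = 0 := by
    intro k i
    obtain ⟨s, hk⟩ := exists_ne k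
    have h1 := entry (Sum.inr s) (Sum.inl k) (Sum.inl i) (Sum.inr s)
    have h3 := entry (Sum.inr s) (Sum.inl k) (Sum.inr i) (Sum.inl s)
    simp only [quadMatrix, Matrix.fromBlocks_apply₁₂, Matrix.fromBlocks_apply₂₁, Matrix.of_apply,
      indSign, one_mul, if_true, if_neg hk.symm] at h1 h3
    refine (mul_eq_zero.1 ?_).resolve_left h2
    linear_combination h1 + h3
  have hl' : ∀ s i, l (Sum.inr s) i = 0 := by
    intro s i
    obtain ⟨k, hk⟩ := exists_ne s
    have h1 := entry (Sum.inr s) (Sum.inl k) (Sum.inl i) (Sum.inr k)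
    have h3 := entry (Sum.inr s) (Sum.inl k) (Sum.inr i) (Sum.inl k)
    simp only [quadMatrix, Matrix.fromBlocks_apply₁₂, Matrix.fromBlocks_apply₂₁, Matrix.of_apply,
      indSign, one_mul, if_true, if_neg hk.symm] at h1 h3
    refine (mul_eq_zero.1 ?_).resolve_left h2
    linear_combination -h1 - h3
  have hm' : ∀ s i, m (Sum.inr s) i = 0 := by
    intro s i
    -- A diagonal block suffices here: the other side only involves values of `l` already known to
    -- vanish, and `k ≠ i` removes the second `m`-term.
    obtain ⟨k, hk⟩ := exists_ne i
    have h1 := entry (Sum.inr s) (Sum.inl k) (Sum.inl i) (Sum.inl k)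
    simp only [quadMatrix, Matrix.fromBlocks_apply₁₁, Matrix.of_apply, indSign, one_mul, if_true,
      if_neg hk.symm, hl, ite_self, sub_zero, zero_add] at h1
    exact neg_eq_zero.1 h1
  constructor <;> funext a i <;> rcases a with a | a
  exacts [hl a i, hl' a i, hm a i, hm' a i]

/-- This is the degree 2 component of the prolong, where coefficients have degree 3. -/
theorem eq_zero_of_pdVect_eq_quadField (h2 : (2 : K) ≠ 0) (hn : 1 < n) {X : Vect K n}
    (hdeg : X ∈ vectCoeffDeg K 3) (hX : ∀ a, ∃ l m, pdVect K a X = quadField l m) : X = 0 := by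
  choose l m hlm using hX
  obtain ⟨rfl, rfl⟩ := eq_zero_of_quadMatrix_comm h2 hn
    (matrix_comm_of_pdVect_eq hlm fun a c => pdVect_quadField (l a) (m a) c)
  exact eq_zero_of_pdVect_eq_zero hdeg fun a => (hlm a).trans quadField_zero

/-! ### The prolong -/

section

variable {p : ℕ} {N : Fin n → ℕ∞}

theorem mem_prolongComp_one [CharP K p] (hp : p ≠ 2) (h2 : (2 : K) ≠ 0) (hN : ∀ i, 1 ≤ N i)
    {X : Vect K n} :
    X ∈ prolongComp K p N (idModule K n)
        ((queer K n ⊔ Submodule.span K {opJ K n}).map (linField K n)) 1 ↔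
      ∃ l m, X = quadField l m := by
  rw [← zero_add 1, mem_prolongComp_succ]
  constructor
  · rintro ⟨-, hdeg, hX⟩
    exact eq_quadField_of_pdVect_mem h2 hdeg hX
  · rintro ⟨l, m, rfl⟩
    refine ⟨quadField_mem_shearedVect hp hN l m, quadField_mem_vectCoeffDeg l m, fun a => ?_⟩
    rw [pdVect_quadField]
    exact Submodule.mem_map_of_mem (quadMatrix_mem l m a)

theorem prolongComp_add_two [CharP K p] (hp : p ≠ 2) (h2 : (2 : K) ≠ 0) (hn : 1 < n)
    (hN : ∀ i, 1 ≤ N i) (k : ℕ) :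
    prolongComp K p N (idModule K n)
        ((queer K n ⊔ Submodule.span K {opJ K n}).map (linField K n)) (k + 2) = ⊥ := by
  rw [Submodule.eq_bot_iff]
  induction k with
  | zero =>
    intro X hX
    obtain ⟨-, hdeg, hX⟩ := mem_prolongComp_succ.1 hX
    exact eq_zero_of_pdVect_eq_quadField h2 hn hdeg fun a =>
      (mem_prolongComp_one hp h2 hN).1 (hX a)
  | succ k ih =>
    intro X hX
    obtain ⟨-, hdeg, hX⟩ := mem_prolongComp_succ.1 hX
    exact eq_zero_of_pdVect_eq_zero hdeg fun a => ih _ (hX a)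

theorem cartanProlong_eq_range_phi [CharP K p] (hp : p ≠ 2) (h2 : (2 : K) ≠ 0) (hn : 1 < n)
    (hN : ∀ i, 1 ≤ N i) :
    cartanProlong K p N (idModule K n)
        ((queer K n ⊔ Submodule.span K {opJ K n}).map (linField K n)) =
      LinearMap.range (phi K n) := by
  have hE : ∀ i j, phiE K i j ∈ LinearMap.range (phi K n) := fun i j =>
    ⟨_, phi_unitE i j⟩
  have hX : ∀ i j, phiX K i j ∈ LinearMap.range (phi K n) := fun i j =>
    ⟨_, phi_unitX i j⟩
  apply le_antisymm
  · refine sup_le ?_ (iSup_le fun k => ?_)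
    · rw [← map_phi_qNegOne]
      exact LinearMap.map_le_range
    · rcases k with _ | _ | k
      · rw [prolongComp, ← map_phi_qZero]
        exact LinearMap.map_le_range
      · intro X hX'
        obtain ⟨l, m, rfl⟩ := (mem_prolongComp_one hp h2 hN).1 hX'
        exact Submodule.sum_mem _ fun k _ => Submodule.add_mem _
          (Submodule.smul_mem _ _ (hX _ _)) (Submodule.smul_mem _ _ (hE _ _))
      · rw [prolongComp_add_two hp h2 hn hN]
        exact bot_le
  · set P := cartanProlong K p N (idModule K n)
      ((queer K n ⊔ Submodule.span K {opJ K n}).map (linField K n))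
    have hneg : idModule K n ≤ P := le_sup_left
    have hcomp : ∀ k, prolongComp K p N (idModule K n)
        ((queer K n ⊔ Submodule.span K {opJ K n}).map (linField K n)) k ≤ P := fun k =>
      (le_iSup (fun k => prolongComp K p N (idModule K n)
        ((queer K n ⊔ Submodule.span K {opJ K n}).map (linField K n)) k) k).trans le_sup_right
    have hzero : (qZero K n).map (phi K n) ≤ P := by
      rw [map_phi_qZero]
      exact hcomp 0
    have hone : ∀ l m, quadField l m ∈ P := fun l m =>
      hcomp 1 ((mem_prolongComp_one hp h2 hN).2 ⟨l, m, rfl⟩)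
    have hEP : ∀ i j, phiE K i j ∈ P := by
      intro i j
      refine Fin.cases ?_ (fun i => ?_) i <;> refine Fin.cases ?_ (fun j => ?_) j
      · rw [← phi_unitE]
        exact hzero (Submodule.mem_map_of_mem (Submodule.subset_span (Or.inl (Or.inl rfl))))
      · exact hneg (Submodule.subset_span ⟨Sum.inl j, rfl⟩)
      -- With one parameter equal to 1 and all others 0, the quadratic field is `φ(E_{i0})` itself.
      · have := hone 0 (Pi.single i 1)
        simpa [quadField, Pi.single_apply, ite_smul] using this
      · rw [← phi_unitE]
        exact hzero (Submodule.mem_map_of_mem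
          (Submodule.subset_span (Or.inr (Or.inl ⟨(i, j), rfl⟩))))
    have hXP : ∀ i j, phiX K i j ∈ P := by
      intro i j
      refine Fin.cases ?_ (fun i => ?_) i <;> refine Fin.cases ?_ (fun j => ?_) j
      · rw [← phi_unitX]
        exact hzero (Submodule.mem_map_of_mem (Submodule.subset_span (Or.inl (Or.inr rfl))))
      · exact hneg (Submodule.subset_span ⟨Sum.inr j, rfl⟩)
      · have := hone (Pi.single i 1) 0
        simpa [quadField, Pi.single_apply, ite_smul] using this
      · rw [← phi_unitX]
        exact hzero (Submodule.mem_map_of_mem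
          (Submodule.subset_span (Or.inr (Or.inr ⟨(i, j), rfl⟩))))
    rintro _ ⟨Q, rfl⟩
    change ∑ i, ∑ j, (Q.1 i j • phiE K i j + Q.2 i j • phiX K i j) ∈ P
    exact Submodule.sum_mem _ fun i _ => Submodule.sum_mem _ fun j _ => Submodule.add_mem _
      (Submodule.smul_mem _ _ (hEP i j)) (Submodule.smul_mem _ _ (hXP i j))

end

end QueerProlong

theorem mainTheorem6 (K : Type*) [Field K] (p : ℕ) [CharP K p] (hp : p ≠ 2)
    (n : ℕ) (hn : 1 < n) (N : Fin n → ℕ∞) (hN : ∀ i, 1 ≤ N i) :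
    Disjoint (QueerProlong.queer K n) (Submodule.span K {QueerProlong.opJ K n}) ∧
    QueerProlong.cartanProlong K p N
        ((QueerProlong.qNegOne K n).map (QueerProlong.phi K n))
        ((QueerProlong.qZero K n).map (QueerProlong.phi K n)) =
      QueerProlong.cartanProlong K p N
        (QueerProlong.idModule K n)
        ((QueerProlong.queer K n ⊔ Submodule.span K {QueerProlong.opJ K n}).map
          (QueerProlong.linField K n)) ∧
    QueerProlong.cartanProlong K p N
        (QueerProlong.idModule K n)
        ((QueerProlong.queer K n ⊔ Submodule.span K {QueerProlong.opJ K n}).map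
          (QueerProlong.linField K n)) =
      LinearMap.range (QueerProlong.phi K n) := by
  have h2 : (2 : K) ≠ 0 := Ring.two_ne_zero (by rwa [ringChar.eq K p])
  refine ⟨QueerProlong.disjoint_queer_opJ h2 (by omega), ?_,
    QueerProlong.cartanProlong_eq_range_phi hp h2 hn hN⟩
  -- The two prolongs agree because their initial data are the same subspaces.
  rw [QueerProlong.map_phi_qNegOne, QueerProlong.map_phi_qZero]
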